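/- Let \((\mathcal P,\mathcal L)\) be an affine plane: the lines \(\ell\in\mathcal L\) are sets of points, two distinct points lie on exactly one line, for a point \(P\) off a line \(\ell\) there is exactly one line through \(P\) disjoint from \(\ell\), and there are three non-collinear points. Two lines are parallel if they are equal or disjoint; \(\ell^{PQ}\) is the line through distinct points \(P,Q\), and \(\ell^{P}_{m}\) is the line through \(P\) parallel to the line \(m\). Assume Desargues' axiom: whenever \(\ell^{AA'},\ell^{BB'},\ell^{CC'}\) are distinct lines which are either pairwise parallel or concurrent in one point, and \(\ell^{AB}\parallel\ell^{A'B'}\), \(\ell^{BC}\parallel\ell^{B'C'}\) (where the points joined are distinct and \(\ell^{AC}\), \(\ell^{A'C'}\) are distinct from each other and from the first three lines, \(\ell^{AB}\ne\ell^{A'B'}\), \(\ell^{BC}\ne\ell^{B'C'}\)), then \(\ell^{AC}\parallel\ell^{A'C'}\). Fix distinct points \(O,I\). For \(A,B\in\ell^{OI}\) choose a point \(B_1\notin\ell^{OI}\). The sum \(A+B\) is the point \(\ell^{P_1}_{BB_1}\cap\ell^{OI}\), where \(P_1=\ell^{B_1}_{OI}\cap\ell^{A}_{OB_1}\); the product \(A\cdot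 B\) is the point \(\ell^{P_1}_{BB_1}\cap\ell^{OI}\), where \(P_1=\ell^{A}_{IB_1}\cap\ell^{OB_1}\); neither depends on the choice of \(B_1\). Write \(-A\) for the point with \(A+(-A)=O=(-A)+A\), \(A-B=A+(-B)\), and, for \(A\ne O\), \(A^{-1}\) for the point with \(A\cdot A^{-1}=I=A^{-1}\cdot A\). The cross-ratio of points of \(\ell^{OI}\) is \[c_r(A,B;C,D)=\left[(A-D)^{-1}(B-D)\right]\left[(B-C)^{-1}(A-C)\right]\qquad(A\ne D,\ B\ne C).\] **Theorem.** Let \(A,B,C\in\ell^{OI}\) be pairwise distinct and different from \(O\). Put \(f_D(X)=c_r(A,B;C,X)\) for \(X\in\ell^{OI}\), \(X\neq A\), and let \(\mathcal R^D_4=\{f_D(X): X\in\ell^{OI},\ X\ne A\}\). Then addition of points, applied to elements of \(\mathcal R^D_4\), satisfies: 1. \((u+v)+w=u+(v+w)\) for all \(u,v,w\in\mathcal R^D_4\); 2. \(u+v=v+u\) for all \(u,v\in\mathcal R^D_4\); 3. \(f_D(B)=O\) is an element of \(\mathcal R^D_4\), and \(u+f_D(B)=u=f_D(B)+u\) for all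 \(u\in\mathcal R^D_4\). -/

import Mathlib

/-- An affine plane: a set `P` of points together with a family of lines (sets of points). -/
structure AffinePlane (P : Type*) where
  /-- the family of lines -/
  lines : Set (Set P)
  /-- two distinct points lie on exactly one line -/
  existsUnique_line : ∀ p q : P, p ≠ q → ∃! l : Set P, l ∈ lines ∧ p ∈ l ∧ q ∈ l
  /-- Playfair: through a point off a line there is exactly one line missing that line -/
  existsUnique_parallel : ∀ (p : P) (l : Set P), l ∈ lines → p ∉ l →
    ∃! m : Set P, m ∈ lines ∧ p ∈ m ∧ l ∩ m = ∅
  /-- there are three distinct points that do not lie on a common line -/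
  exists_noncollinear : ∃ p q r : P, p ≠ q ∧ p ≠ r ∧ q ≠ r ∧
    ∀ l ∈ lines, ¬ (p ∈ l ∧ q ∈ l ∧ r ∈ l)

namespace AffinePlane

variable {P : Type*} (S : AffinePlane P)

/-- The line through two distinct points `p`, `q` (the union of the one-element family of all
lines containing both). -/
def join (p q : P) : Set P := ⋃₀ {l | l ∈ S.lines ∧ p ∈ l ∧ q ∈ l}

/-- Parallelism of lines: equal or disjoint. -/
def Parallel (l m : Set P) : Prop := l = m ∨ l ∩ m = ∅

/-- The line through the point `p` parallel to the line `l` (the union of the one-element family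
of all lines through `p` parallel to `l`). -/
def par (p : P) (l : Set P) : Set P := ⋃₀ {m | m ∈ S.lines ∧ p ∈ m ∧ Parallel l m}

theorem join_spec {p q : P} (h : p ≠ q) :
    S.join p q ∈ S.lines ∧ p ∈ S.join p q ∧ q ∈ S.join p q := by
  obtain ⟨l, hl, hu⟩ := S.existsUnique_line p q h
  have e : S.join p q = l := by
    have : {l | l ∈ S.lines ∧ p ∈ l ∧ q ∈ l} = {l} := by
      ext m
      exact ⟨fun hm => hu m hm, fun hm => by rw [Set.mem_singleton_iff.mp hm]; exact hl⟩
    rw [join, this, Set.sUnion_singleton]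
  rw [e]
  exact hl

theorem join_unique {p q : P} (h : p ≠ q) {l : Set P} (hl : l ∈ S.lines) (hp : p ∈ l)
    (hq : q ∈ l) : l = S.join p q :=
  (S.existsUnique_line p q h).unique ⟨hl, hp, hq⟩ (S.join_spec h)

theorem par_existsUnique (p : P) {l : Set P} (hl : l ∈ S.lines) :
    ∃! m : Set P, m ∈ S.lines ∧ p ∈ m ∧ Parallel l m := by
  by_cases hp : p ∈ l
  · refine ⟨l, ⟨hl, hp, Or.inl rfl⟩, ?_⟩
    rintro m ⟨-, hpm, h | h⟩
    · exact h.symm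
    · exact absurd (h ▸ (⟨hp, hpm⟩ : p ∈ l ∩ m)) (Set.notMem_empty p)
  · obtain ⟨m, ⟨h1, h2, h3⟩, hu⟩ := S.existsUnique_parallel p l hl hp
    refine ⟨m, ⟨h1, h2, Or.inr h3⟩, ?_⟩
    rintro n ⟨k1, k2, h | h⟩
    · exact absurd (h ▸ k2) hp
    · exact hu n ⟨k1, k2, h⟩

theorem par_spec (p : P) {l : Set P} (hl : l ∈ S.lines) :
    S.par p l ∈ S.lines ∧ p ∈ S.par p l ∧ Parallel l (S.par p l) := by
  obtain ⟨m, hm, hu⟩ := S.par_existsUnique p hl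
  have e : S.par p l = m := by
    have : {m | m ∈ S.lines ∧ p ∈ m ∧ Parallel l m} = {m} := by
      ext n
      exact ⟨fun hn => hu n hn, fun hn => by rw [Set.mem_singleton_iff.mp hn]; exact hm⟩
    rw [par, this, Set.sUnion_singleton]
  rw [e]
  exact hm

/-- Desargues' axiom, in its parallel and its central form: if the vertices of the triangles
`ABC` and `A'B'C'` are joined by three lines that are parallel or meet in one point, and
`AB ∥ A'B'`, `BC ∥ B'C'`, then `AC ∥ A'C'`. -/
def IsDesarguesian : Prop :=
  ∀ A B C A' B' C' : P,
    A ≠ A' → B ≠ B' → C ≠ C' → A ≠ B → A' ≠ B' → B ≠ C → B' ≠ C' → A ≠ C → A' ≠ C' →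
    [S.join A A', S.join B B', S.join C C', S.join A C, S.join A' C'].Nodup →
    S.join A B ≠ S.join A' B' → S.join B C ≠ S.join B' C' →
    ((Parallel (S.join A A') (S.join B B') ∧ Parallel (S.join B B') (S.join C C') ∧
        Parallel (S.join A A') (S.join C C')) ∨
      ∃ Q : P, S.join A A' ∩ S.join B B' ∩ S.join C C' = {Q}) →
    Parallel (S.join A B) (S.join A' B') →
    Parallel (S.join B C) (S.join B' C') →
    Parallel (S.join A C) (S.join A' C')

/-- Two distinct base points `O`, `I`, which fix the line `OI`. -/
structure Frame {P : Type*} (S : AffinePlane P) where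
  /-- the zero point -/
  O : P
  /-- the unit point -/
  I : P
  /-- the base points are distinct -/
  ne : O ≠ I

namespace Frame

variable {S} (F : S.Frame)

/-- The line `OI`. -/
def line : Set P := S.join F.O F.I

/-- The points of the line `OI`. -/
def Pt : Type _ := {x : P // x ∈ F.line}

instance : Zero F.Pt := ⟨⟨F.O, (S.join_spec F.ne).2.1⟩⟩

instance : One F.Pt := ⟨⟨F.I, (S.join_spec F.ne).2.2⟩⟩

instance : Nonempty F.Pt := ⟨0⟩

/-- `C` is the outcome of the addition construction for `A` and `B`: for an auxiliary point `B₁`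
off `OI`, let `P₁` be the intersection of the parallel to `OI` through `B₁` with the parallel to
`OB₁` through `A`; then `C` is the intersection of the parallel to `BB₁` through `P₁`
with `OI`. -/
def IsSum (A B C : P) : Prop :=
  ∃ B₁ : P, B₁ ∉ F.line ∧ ∃ P₁ : P,
    S.par B₁ F.line ∩ S.par A (S.join F.O B₁) = {P₁} ∧
    S.par P₁ (S.join B B₁) ∩ F.line = {C}

/-- `C` is the outcome of the multiplication construction for `A` and `B`: for an auxiliary point
`B₁` off `OI`, let `P₁` be the intersection of the parallel to `IB₁` through `A` with
`OB₁`; then `C` is the intersection of the parallel to `BB₁` through `P₁` with `OI`. -/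
def IsProd (A B C : P) : Prop :=
  ∃ B₁ : P, B₁ ∉ F.line ∧ ∃ P₁ : P,
    S.par A (S.join F.I B₁) ∩ S.join F.O B₁ = {P₁} ∧
    S.par P₁ (S.join B B₁) ∩ F.line = {C}

/-- The sum of two points of `OI`: the point given by the addition construction. -/
noncomputable instance : Add F.Pt :=
  ⟨fun A B => Classical.epsilon fun C : F.Pt => F.IsSum A.1 B.1 C.1⟩

/-- The product of two points of `OI`: the point given by the multiplication construction. -/
noncomputable instance : Mul F.Pt :=
  ⟨fun A B => Classical.epsilon fun C : F.Pt => F.IsProd A.1 B.1 C.1⟩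

/-- The opposite point: the point `N` with `A + N = O = N + A`. -/
noncomputable instance : Neg F.Pt :=
  ⟨fun A => Classical.epsilon fun N : F.Pt => A + N = 0 ∧ N + A = 0⟩

noncomputable instance : Sub F.Pt := ⟨fun A B => A + -B⟩

/-- The inverse of a point `A ≠ O`: the point `N` with `A * N = I = N * A`.
At `A = O` the value is meaningless. -/
noncomputable instance : Inv F.Pt :=
  ⟨fun A => Classical.epsilon fun N : F.Pt => A * N = 1 ∧ N * A = 1⟩

variable {F}

/-- The cross-ratio of four points of `OI`; meaningful when `A ≠ D` and `B ≠ C`. -/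
noncomputable def crossRatio (A B C D : F.Pt) : F.Pt :=
  ((A - D)⁻¹ * (B - D)) * ((B - C)⁻¹ * (A - C))

/-- The map `X ↦ c_r(A, B; C, X)`. -/
noncomputable def fD (A B C : F.Pt) (X : F.Pt) : F.Pt := crossRatio A B C X

/-- The set of all values `c_r(A, B; C, X)`, where `X` runs over the points of `OI` at which the
cross-ratio is defined, that is, `X ≠ A`. -/
def ratioSetD (A B C : F.Pt) : Set F.Pt := {Y | ∃ X : F.Pt, X ≠ A ∧ Y = fD A B C X}

end Frame

end AffinePlane

namespace AffinePlane

variable {P : Type*} {S : AffinePlane P}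

/-! The set of cross-ratio values plays almost no role: on the whole line `OI`, addition is
associative and commutative with neutral element `O`, and the value at `B` is `O` because `B - B =
O` and a product with a factor `O` is `O`.

The key fact is that a sum does not depend on its auxiliary point (`sumVia_unique`). It follows from
Desargues for three parallel lines; the central form is never used. Each law then comes from a good
choice of auxiliary points. For `add_assoc`, the intermediate point of one sum serves as auxiliary
point of the next. For `add_comm`, two auxiliary points completing a parallelogram are compared by
two further uses of Desargues.

Independence of the auxiliary point is not needed for products: with a factor `O`, every auxiliary
point visibly gives `O`. -/

theorem Parallel.refl (l : Set P) : Parallel l l := Or.inl rfl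

theorem Parallel.symm {l m : Set P} (h : Parallel l m) : Parallel m l :=
  h.imp Eq.symm fun h => by rw [Set.inter_comm]; exact h

theorem Parallel.eq_of_mem {l m : Set P} (h : Parallel l m) {p : P} (hl : p ∈ l) (hm : p ∈ m) :
    l = m :=
  h.resolve_right fun h => Set.notMem_empty p (h ▸ ⟨hl, hm⟩)

theorem Parallel.trans {l m n : Set P} (h : Parallel l m) (h' : Parallel m n)
    (hl : l ∈ S.lines) (hm : m ∈ S.lines) (hn : n ∈ S.lines) : Parallel l n := by
  by_cases he : l ∩ n = ∅
  · exact Or.inr he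
  · obtain ⟨p, hpl, hpn⟩ := Set.nonempty_iff_ne_empty.mpr he
    exact Or.inl ((S.par_existsUnique p hm).unique ⟨hl, hpl, h.symm⟩ ⟨hn, hpn, h'⟩)

theorem exists_mem_of_not_parallel {l m : Set P} (h : ¬ Parallel l m) : ∃ p, p ∈ l ∧ p ∈ m :=
  Set.nonempty_iff_ne_empty.mpr fun he => h (Or.inr he)

theorem line_eq {l m : Set P} (hl : l ∈ S.lines) (hm : m ∈ S.lines) {p q : P} (h : p ≠ q)
    (hpl : p ∈ l) (hql : q ∈ l) (hpm : p ∈ m) (hqm : q ∈ m) : l = m :=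
  (S.join_unique h hl hpl hql).trans (S.join_unique h hm hpm hqm).symm

theorem exists_line_mem (S : AffinePlane P) (p q : P) : ∃ l ∈ S.lines, p ∈ l ∧ q ∈ l := by
  by_cases h : p = q
  · obtain ⟨a, b, -, hab, -⟩ := S.exists_noncollinear
    have := S.par_spec p (S.join_spec hab).1
    exact ⟨_, this.1, this.2.1, h ▸ this.2.1⟩
  · exact ⟨_, S.join_spec h⟩

/-! ### Parallelism of point pairs, degenerate pairs allowed -/

variable (S) in
/-- Some line through `a`, `b` is parallel to some line through `c`, `d`. For `a ≠ b` and `c ≠ d`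
this says that the lines `ab` and `cd` are parallel. -/
def PairParallel (a b c d : P) : Prop :=
  ∃ l ∈ S.lines, ∃ m ∈ S.lines, (a ∈ l ∧ b ∈ l) ∧ (c ∈ m ∧ d ∈ m) ∧ Parallel l m

namespace PairParallel

variable {a b c d e f : P}

theorem refl (S : AffinePlane P) (a b : P) : S.PairParallel a b a b := by
  obtain ⟨l, hl, h⟩ := exists_line_mem S a b
  exact ⟨l, hl, l, hl, h, h, Parallel.refl l⟩

theorem symm (h : S.PairParallel a b c d) : S.PairParallel c d a b := by
  obtain ⟨l, hl, m, hm, h1, h2, h3⟩ := h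
  exact ⟨m, hm, l, hl, h2, h1, h3.symm⟩

theorem swap_left (h : S.PairParallel a b c d) : S.PairParallel b a c d := by
  obtain ⟨l, hl, m, hm, h1, h2, h3⟩ := h
  exact ⟨l, hl, m, hm, h1.symm, h2, h3⟩

theorem swap_right (h : S.PairParallel a b c d) : S.PairParallel a b d c :=
  h.symm.swap_left.symm

theorem swap (h : S.PairParallel a b c d) : S.PairParallel b a d c :=
  h.swap_left.swap_right

theorem trans (h : S.PairParallel a b c d) (h' : S.PairParallel c d e f) (hcd : c ≠ d) :
    S.PairParallel a b e f := by
  obtain ⟨l, hl, m, hm, h1, h2, h3⟩ := h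
  obtain ⟨m', hm', n, hn, k1, k2, k3⟩ := h'
  obtain rfl := line_eq hm hm' hcd h2.1 h2.2 k1.1 k1.2
  exact ⟨l, hl, n, hn, h1, k2, h3.trans k3 hl hm hn⟩

theorem of_mem {l m : Set P} (hl : l ∈ S.lines) (hm : m ∈ S.lines) (h : Parallel l m)
    (ha : a ∈ l) (hb : b ∈ l) (hc : c ∈ m) (hd : d ∈ m) : S.PairParallel a b c d :=
  ⟨l, hl, m, hm, ⟨ha, hb⟩, ⟨hc, hd⟩, h⟩

theorem join_parallel (h : S.PairParallel a b c d) (hab : a ≠ b) (hcd : c ≠ d) :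
    Parallel (S.join a b) (S.join c d) := by
  obtain ⟨l, hl, m, hm, h1, h2, h3⟩ := h
  rw [← S.join_unique hab hl h1.1 h1.2, ← S.join_unique hcd hm h2.1 h2.2]
  exact h3

theorem of_join_parallel (hab : a ≠ b) (hcd : c ≠ d)
    (h : Parallel (S.join a b) (S.join c d)) : S.PairParallel a b c d :=
  ⟨_, (S.join_spec hab).1, _, (S.join_spec hcd).1, (S.join_spec hab).2, (S.join_spec hcd).2, h⟩

theorem mem_par (h : S.PairParallel a b c d) (hcd : c ≠ d) : b ∈ S.par a (S.join c d) := by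
  obtain ⟨l, hl, m, hm, h1, h2, h3⟩ := h
  exact ⟨l, ⟨hl, h1.1, S.join_unique hcd hm h2.1 h2.2 ▸ h3.symm⟩, h1.2⟩

theorem of_mem_par (hcd : c ≠ d) (h : b ∈ S.par a (S.join c d)) : S.PairParallel a b c d := by
  have hs := S.par_spec a (S.join_spec hcd).1
  exact ⟨_, hs.1, _, (S.join_spec hcd).1, ⟨hs.2.1, h⟩, (S.join_spec hcd).2, hs.2.2.symm⟩

end PairParallel

/-! ### Directions transverse to a line -/

variable (S) in
/-- No line through `q` and `r` is parallel to `l`; in particular `q ≠ r`. -/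
def Transverse (l : Set P) (q r : P) : Prop :=
  ∀ m ∈ S.lines, q ∈ m → r ∈ m → ¬ Parallel l m

namespace Transverse

variable {l m : Set P} {q r q' r' : P}

theorem ne (h : S.Transverse l q r) (hl : l ∈ S.lines) : q ≠ r := by
  rintro rfl
  have hs := S.par_spec q hl
  exact h _ hs.1 hs.2.1 hs.2.1 hs.2.2

theorem of_mem_notMem (hl : l ∈ S.lines) (hm : m ∈ S.lines) (h : Parallel l m) (hq : q ∈ m)
    (hr : r ∉ m) : S.Transverse l q r := fun _ hn hqn hrn hln =>
  hr ((h.symm.trans hln hm hl hn).eq_of_mem hq hqn ▸ hrn)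

theorem symm (h : S.Transverse l q r) : S.Transverse l r q :=
  fun m hm hr hq => h m hm hq hr

theorem of_pairParallel (h : S.Transverse l q r) (hl : l ∈ S.lines)
    (h' : S.PairParallel q r q' r') (hne : q' ≠ r') : S.Transverse l q' r' := by
  intro m hm hq hr hlm
  obtain ⟨n, hn, m', hm', h1, h2, h3⟩ := h'
  obtain rfl := line_eq hm hm' hne hq hr h2.1 h2.2
  exact h n hn h1.1 h1.2 (hlm.trans h3.symm hl hm hn)

theorem exists_mem (h : S.Transverse l q r) (hl : l ∈ S.lines) (p : P) :
    ∃ c ∈ l, S.PairParallel p c q r := by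
  have hj := S.join_spec (h.ne hl)
  have hs := S.par_spec p hj.1
  obtain ⟨c, hc, hc'⟩ := exists_mem_of_not_parallel (l := l) (m := S.par p (S.join q r))
    fun hp => h _ hj.1 hj.2.1 hj.2.2 (hp.trans hs.2.2.symm hl hs.1 hj.1)
  exact ⟨c, hc, .of_mem_par (h.ne hl) hc'⟩

theorem eq_of_mem (h : S.Transverse l q r) (hl : l ∈ S.lines) {p c c' : P} (hc : c ∈ l)
    (hc' : c' ∈ l) (hp : S.PairParallel p c q r) (hp' : S.PairParallel p c' q r) : c = c' := by
  by_contra hne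
  have h1 := hp.mem_par (h.ne hl)
  have h2 := hp'.mem_par (h.ne hl)
  have hj := S.join_spec (h.ne hl)
  have hs := S.par_spec p hj.1
  have he := line_eq hl hs.1 hne hc hc' h1 h2
  exact h _ hj.1 hj.2.1 hj.2.2 (he ▸ hs.2.2.symm)

theorem par_inter (h : S.Transverse l q r) (hl : l ∈ S.lines) {p c : P} (hc : c ∈ l)
    (hp : S.PairParallel p c q r) : S.par p (S.join q r) ∩ l = {c} := by
  ext x
  constructor
  · rintro ⟨hx, hxl⟩
    exact h.eq_of_mem hl hxl hc (.of_mem_par (h.ne hl) hx) hp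
  · rintro rfl
    exact ⟨hp.mem_par (h.ne hl), hc⟩

end Transverse

/-! ### Desargues for parallel lines -/

/-- Desargues' theorem for three parallel lines, without nondegeneracy conditions on the
triangles. -/
theorem IsDesarguesian.parallel (hS : S.IsDesarguesian) {l₁ l₂ l₃ : Set P} (h₁ : l₁ ∈ S.lines)
    (h₂ : l₂ ∈ S.lines) (h₃ : l₃ ∈ S.lines) (h₁₂ : Parallel l₁ l₂) (h₂₃ : Parallel l₂ l₃)
    (n₁₂ : l₁ ≠ l₂) (n₂₃ : l₂ ≠ l₃) (n₁₃ : l₁ ≠ l₃) {A A' B B' C C' : P}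
    (hA : A ∈ l₁) (hA' : A' ∈ l₁) (hB : B ∈ l₂) (hB' : B' ∈ l₂) (hC : C ∈ l₃) (hC' : C' ∈ l₃)
    (hAB : S.PairParallel A B A' B') (hBC : S.PairParallel B C B' C') :
    S.PairParallel A C A' C' := by
  have h₁₃ := h₁₂.trans h₂₃ h₁ h₂ h₃
  have d₁₂ : ∀ x ∈ l₁, x ∉ l₂ := fun x hx hx' => n₁₂ (h₁₂.eq_of_mem hx hx')
  have d₂₃ : ∀ x ∈ l₂, x ∉ l₃ := fun x hx hx' => n₂₃ (h₂₃.eq_of_mem hx hx')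
  have d₁₃ : ∀ x ∈ l₁, x ∉ l₃ := fun x hx hx' => n₁₃ (h₁₃.eq_of_mem hx hx')
  have nAB : A ≠ B := fun h => d₁₂ A hA (h ▸ hB)
  have nAB' : A' ≠ B' := fun h => d₁₂ A' hA' (h ▸ hB')
  have nBC : B ≠ C := fun h => d₂₃ B hB (h ▸ hC)
  have nBC' : B' ≠ C' := fun h => d₂₃ B' hB' (h ▸ hC')
  have nAC : A ≠ C := fun h => d₁₃ A hA (h ▸ hC)
  have nAC' : A' ≠ C' := fun h => d₁₃ A' hA' (h ▸ hC')
  have tAB : S.Transverse l₂ A B :=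
    (Transverse.of_mem_notMem h₂ h₂ (.refl _) hB (d₁₂ A hA)).symm
  have tBA : S.Transverse l₁ B A :=
    Transverse.of_mem_notMem h₁ h₂ h₁₂ hB (d₁₂ A hA)
  have tBC : S.Transverse l₃ B C :=
    (Transverse.of_mem_notMem h₃ h₃ (.refl _) hC (d₂₃ B hB)).symm
  have tCB : S.Transverse l₂ C B :=
    Transverse.of_mem_notMem h₂ h₃ h₂₃ hC (d₂₃ B hB)
  have eAB : A = A' → B = B' := by
    rintro rfl
    exact tAB.eq_of_mem h₂ hB hB' (.refl S A B) hAB.symm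
  have eBA : B = B' → A = A' := by
    rintro rfl
    exact tBA.eq_of_mem h₁ hA hA' (.refl S B A) hAB.symm.swap
  have eBC : B = B' → C = C' := by
    rintro rfl
    exact tBC.eq_of_mem h₃ hC hC' (.refl S B C) hBC.symm
  have eCB : C = C' → B = B' := by
    rintro rfl
    exact tCB.eq_of_mem h₂ hB hB' (.refl S C B) hBC.symm.swap
  -- Each vertex determines the next one along a side, so one coincidence between the triangles
  -- makes them equal.
  by_cases nA : A = A'
  · rw [← nA, ← eBC (eAB nA)]
    exact .refl S A C
  have nB : B ≠ B' := fun h => nA (eBA h)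
  have nC : C ≠ C' := fun h => nB (eCB h)
  have jA := S.join_unique nA h₁ hA hA'
  have jB := S.join_unique nB h₂ hB hB'
  have jC := S.join_unique nC h₃ hC hC'
  have sAB := S.join_spec nAB
  have sAB' := S.join_spec nAB'
  have sBC := S.join_spec nBC
  have sBC' := S.join_spec nBC'
  have sAC := S.join_spec nAC
  have sAC' := S.join_spec nAC'
  by_cases he : S.join A C = S.join A' C'
  · exact .of_join_parallel nAC nAC' (Or.inl he)
  refine .of_join_parallel nAC nAC' (hS A B C A' B' C' nA nB nC nAB nAB' nBC nBC' nAC nAC'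
    ?_ ?_ ?_ (Or.inl ?_) (hAB.join_parallel nAB nAB') (hBC.join_parallel nBC nBC'))
  -- A side meeting two of the distinct parallels cannot be one of the three, since it would then
  -- meet another of them.
  · rw [← jA, ← jB, ← jC]
    have a1 : l₁ ≠ S.join A C := fun h => d₁₃ C (h ▸ sAC.2.2) hC
    have a2 : l₁ ≠ S.join A' C' := fun h => d₁₃ C' (h ▸ sAC'.2.2) hC'
    have a3 : l₂ ≠ S.join A C := fun h => d₂₃ C (h ▸ sAC.2.2) hC
    have a4 : l₂ ≠ S.join A' C' := fun h => d₂₃ C' (h ▸ sAC'.2.2) hC'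
    have a5 : l₃ ≠ S.join A C := fun h => d₁₃ A hA (h ▸ sAC.2.1)
    have a6 : l₃ ≠ S.join A' C' := fun h => d₁₃ A' hA' (h ▸ sAC'.2.1)
    simp [n₁₂, n₂₃, n₁₃, a1, a2, a3, a4, a5, a6, he]
  · intro h
    have := line_eq h₁ sAB.1 nA hA hA' sAB.2.1 (h ▸ sAB'.2.1)
    exact d₁₂ B (this ▸ sAB.2.2) hB
  · intro h
    have := line_eq h₂ sBC.1 nB hB hB' sBC.2.1 (h ▸ sBC'.2.1)
    exact d₂₃ C (this ▸ sBC.2.2) hC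
  · rw [← jA, ← jB, ← jC]
    exact ⟨h₁₂, h₂₃, h₁₃⟩

/-! ### The addition construction -/

namespace Frame

variable (F : S.Frame)

theorem line_mem : F.line ∈ S.lines := (S.join_spec F.ne).1

theorem O_mem : F.O ∈ F.line := (S.join_spec F.ne).2.1

theorem I_mem : F.I ∈ F.line := (S.join_spec F.ne).2.2

/-- `C` is the outcome of the addition construction for `A` and `B` with auxiliary point `X` and
intermediate point `Y`. -/
def SumVia (A B X Y C : P) : Prop :=
  S.PairParallel X Y F.O F.I ∧ S.PairParallel A Y F.O X ∧ C ∈ F.line ∧ S.PairParallel Y C B X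

variable {F}

theorem transverse {B X : P} (hB : B ∈ F.line) (hX : X ∉ F.line) : S.Transverse F.line B X :=
  .of_mem_notMem F.line_mem F.line_mem (.refl _) hB hX

theorem ne_of_notMem {B X : P} (hB : B ∈ F.line) (hX : X ∉ F.line) : B ≠ X :=
  fun h => hX (h ▸ hB)

theorem transverse_par {B X : P} (hB : B ∈ F.line) (hX : X ∉ F.line) :
    S.Transverse (S.par X F.line) B X := by
  have hs := S.par_spec X F.line_mem
  refine .symm (.of_mem_notMem hs.1 hs.1 (.refl _) hs.2.1 fun h => ?_)
  exact hX (hs.2.2.eq_of_mem hB h ▸ hs.2.1)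

theorem notMem_of_pairParallel {X Y : P} (hX : X ∉ F.line)
    (h : S.PairParallel X Y F.O F.I) : Y ∉ F.line := by
  have h1 : Y ∈ S.par X F.line := h.mem_par F.ne
  have hs := S.par_spec X F.line_mem
  exact fun hY => hX (hs.2.2.eq_of_mem hY h1 ▸ hs.2.1)

theorem pairParallel_of_mem {A B C D : P} (hA : A ∈ F.line) (hB : B ∈ F.line) (hC : C ∈ F.line)
    (hD : D ∈ F.line) : S.PairParallel A B C D :=
  .of_mem F.line_mem F.line_mem (.refl _) hA hB hC hD

theorem exists_shift {A X : P} (hX : X ∉ F.line) :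
    ∃ Y, S.PairParallel X Y F.O F.I ∧ S.PairParallel A Y F.O X := by
  obtain ⟨Y, hY, h⟩ := (transverse_par F.O_mem hX).exists_mem (S.par_spec X F.line_mem).1 A
  exact ⟨Y, .of_mem_par F.ne hY, h⟩

theorem shift_unique {A X Y Y' : P} (hX : X ∉ F.line)
    (h : S.PairParallel X Y F.O F.I) (h1 : S.PairParallel A Y F.O X)
    (h' : S.PairParallel X Y' F.O F.I) (h1' : S.PairParallel A Y' F.O X) : Y = Y' :=
  (transverse_par F.O_mem hX).eq_of_mem (S.par_spec X F.line_mem).1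
    (h.mem_par F.ne) (h'.mem_par F.ne) h1 h1'

theorem exists_sumVia (A : P) {B X : P} (hB : B ∈ F.line) (hX : X ∉ F.line) :
    ∃ Y C, F.SumVia A B X Y C := by
  obtain ⟨Y, h1, h2⟩ := exists_shift (A := A) hX
  obtain ⟨C, hC, h3⟩ := (transverse hB hX).exists_mem F.line_mem Y
  exact ⟨Y, C, h1, h2, hC, h3⟩

theorem isSum_of_sumVia {A B C X Y : P} (hB : B ∈ F.line) (hX : X ∉ F.line)
    (h : F.SumVia A B X Y C) : F.IsSum A B C := by
  obtain ⟨h1, h2, hC, h3⟩ := h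
  refine ⟨X, hX, Y, ?_, (transverse hB hX).par_inter F.line_mem hC h3⟩
  rw [Set.inter_comm]
  exact (transverse_par F.O_mem hX).par_inter (S.par_spec X F.line_mem).1 (h1.mem_par F.ne) h2

theorem exists_sumVia_of_isSum {A B C : P} (hB : B ∈ F.line) (h : F.IsSum A B C) :
    ∃ X, X ∉ F.line ∧ ∃ Y, F.SumVia A B X Y C := by
  obtain ⟨X, hX, Y, h1, h2⟩ := h
  have hY : Y ∈ S.par X F.line ∩ S.par A (S.join F.O X) := h1 ▸ rfl
  have hC : C ∈ S.par Y (S.join B X) ∩ F.line := h2 ▸ rfl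
  exact ⟨X, hX, Y, .of_mem_par F.ne hY.1, .of_mem_par (ne_of_notMem F.O_mem hX) hY.2, hC.2,
    .of_mem_par (ne_of_notMem hB hX) hC.1⟩

theorem exists_notMem (F : S.Frame) : ∃ X, X ∉ F.line := by
  obtain ⟨p, q, r, -, -, -, h⟩ := S.exists_noncollinear
  by_contra! hc
  exact h _ F.line_mem ⟨hc p, hc q, hc r⟩

/-! ### Independence of the auxiliary point -/

/-- `OI` and its parallels through `X` and `X'` are three distinct lines. Desargues for `XOX'` and
`YAY'` gives `XX' ∥ YY'`; then for `BXX'` and `CYY'` it gives `BX' ∥ CY'`, so `C` also solves the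
construction via `X'`. -/
theorem sumVia_unique_of_notMem_par (hS : S.IsDesarguesian) {A B X Y C X' Y' C' : P}
    (hA : A ∈ F.line) (hB : B ∈ F.line) (hX : X ∉ F.line) (hX' : X' ∉ F.line)
    (hXX' : X' ∉ S.par X F.line) (h : F.SumVia A B X Y C) (h' : F.SumVia A B X' Y' C') :
    C = C' := by
  obtain ⟨h1, h2, hC, h3⟩ := h
  obtain ⟨h1', h2', hC', h3'⟩ := h'
  have s := S.par_spec X F.line_mem
  have s' := S.par_spec X' F.line_mem
  have n1 : F.line ≠ S.par X F.line := fun h => hX (h ▸ s.2.1)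
  have n2 : F.line ≠ S.par X' F.line := fun h => hX' (h ▸ s'.2.1)
  have n3 : S.par X F.line ≠ S.par X' F.line := fun h => hXX' (h ▸ s'.2.1)
  have hp := s.2.2.symm.trans s'.2.2 s.1 F.line_mem s'.1
  have hXY : S.PairParallel X X' Y Y' :=
    hS.parallel s.1 F.line_mem s'.1 s.2.2.symm s'.2.2 n1.symm n2 n3 s.2.1 (h1.mem_par F.ne)
      F.O_mem hA s'.2.1 (h1'.mem_par F.ne) h2.symm.swap h2'.symm
  have hBX : S.PairParallel B X' C Y' :=
    hS.parallel F.line_mem s.1 s'.1 s.2.2 hp n1 n3 n2 hB hC s.2.1 (h1.mem_par F.ne)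
      s'.2.1 (h1'.mem_par F.ne) h3.symm.swap_right hXY
  exact (transverse hB hX').eq_of_mem F.line_mem hC hC' hBX.symm.swap_left h3'

/-- If `OI` carries at least three points, then some point lies neither on `OI` nor on the
parallel to `OI` through a given point `X` off `OI`. -/
theorem exists_notMem_notMem_par {U V X : P} (hU : U ∈ F.line) (hV : V ∈ F.line) (hUO : U ≠ F.O)
    (hVO : V ≠ F.O) (hUV : U ≠ V) (hX : X ∉ F.line) :
    ∃ Z, Z ∉ F.line ∧ Z ∉ S.par X F.line := by
  have hOX := S.join_spec (ne_of_notMem F.O_mem hX)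
  have hUX := ne_of_notMem hU hX
  have hs := S.par_spec X F.line_mem
  have hUn : U ∉ S.join F.O X := fun h =>
    hX (line_eq F.line_mem hOX.1 hUO hU F.O_mem h hOX.2.1 ▸ hOX.2.2)
  have t : S.Transverse (S.join F.O X) U X :=
    .symm (.of_mem_notMem hOX.1 hOX.1 (.refl _) hOX.2.2 hUn)
  -- `Z` is the point of `OX` with `VZ ∥ UX`. On `OI` it could only be `O`, making `UX` parallel to
  -- `OI`; on the parallel through `X` it could only be `X`, forcing `U = V`.
  obtain ⟨Z, hZ, h⟩ := t.exists_mem hOX.1 V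
  refine ⟨Z, fun hZl => ?_, fun hZp => ?_⟩
  · have hne : ¬ Z ≠ F.O := fun hne =>
      hX (line_eq F.line_mem hOX.1 hne hZl F.O_mem hZ hOX.2.1 ▸ hOX.2.2)
    rw [not_not.mp hne] at h
    exact (transverse hU hX).of_pairParallel F.line_mem h.symm hVO _ F.line_mem hV F.O_mem
      (.refl _)
  · have hne : ¬ Z ≠ X := fun hne => by
      have he := line_eq hs.1 hOX.1 hne hZp hs.2.1 hZ hOX.2.2
      exact hX (hs.2.2.eq_of_mem F.O_mem (he ▸ hOX.2.1) ▸ hs.2.1)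
    rw [not_not.mp hne] at h
    exact hUV ((transverse hU hX).symm.eq_of_mem F.line_mem hU hV (.refl S X U) h.swap)

/-- When `X` and `X'` lie on a common parallel to `OI`, Desargues has only two lines to work with;
both outcomes are compared with that of a third auxiliary point `Z` off this parallel, which `U` and
`V` provide. -/
theorem sumVia_unique (hS : S.IsDesarguesian) {U V : P} (hU : U ∈ F.line) (hV : V ∈ F.line)
    (hUO : U ≠ F.O) (hVO : V ≠ F.O) (hUV : U ≠ V) {A B X Y C X' Y' C' : P}
    (hA : A ∈ F.line) (hB : B ∈ F.line) (hX : X ∉ F.line) (hX' : X' ∉ F.line)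
    (h : F.SumVia A B X Y C) (h' : F.SumVia A B X' Y' C') : C = C' := by
  by_cases hXX' : X' ∈ S.par X F.line
  · obtain ⟨Z, hZ, hZX⟩ := exists_notMem_notMem_par hU hV hUO hVO hUV hX
    obtain ⟨Y'', C'', h''⟩ := exists_sumVia A hB hZ
    have s := S.par_spec X F.line_mem
    have s' := S.par_spec X' F.line_mem
    have he : S.par X F.line = S.par X' F.line :=
      (s.2.2.symm.trans s'.2.2 s.1 F.line_mem s'.1).eq_of_mem hXX' s'.2.1
    exact (sumVia_unique_of_notMem_par hS hA hB hX hZ hZX h h'').trans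
      (sumVia_unique_of_notMem_par hS hA hB hX' hZ (he ▸ hZX) h' h'').symm
  · exact sumVia_unique_of_notMem_par hS hA hB hX hX' hXX' h h'

/-! ### The laws of addition -/

variable (F) in
/-- The outcome of the addition construction does not depend on the auxiliary point. -/
def SumWellDefined : Prop :=
  ∀ A ∈ F.line, ∀ B ∈ F.line, ∀ X, X ∉ F.line → ∀ X', X' ∉ F.line → ∀ Y C Y' C',
    F.SumVia A B X Y C → F.SumVia A B X' Y' C' → C = C'

/-- Via any auxiliary point, the addition construction produces the sum. -/
theorem SumWellDefined.sumVia_add (h : F.SumWellDefined) (A B : F.Pt) {X : P}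
    (hX : X ∉ F.line) : ∃ Y, F.SumVia A.1 B.1 X Y (A + B).1 := by
  obtain ⟨Y, C, hC⟩ := exists_sumVia A.1 B.2 hX
  have hs : F.IsSum A.1 B.1 (A + B).1 :=
    Classical.epsilon_spec (p := fun C : F.Pt => F.IsSum A.1 B.1 C.1)
      ⟨⟨C, hC.2.2.1⟩, isSum_of_sumVia B.2 hX hC⟩
  obtain ⟨X', hX', Y', h'⟩ := exists_sumVia_of_isSum B.2 hs
  have := h _ A.2 _ B.2 _ hX _ hX' _ _ _ _ hC h'
  exact ⟨Y, this ▸ hC⟩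

theorem SumWellDefined.add_eq (h : F.SumWellDefined) {A B C : F.Pt} {X Y : P}
    (hX : X ∉ F.line) (hC : F.SumVia A.1 B.1 X Y C.1) : A + B = C := by
  obtain ⟨Y', h'⟩ := h.sumVia_add A B hX
  exact Subtype.ext (h _ A.2 _ B.2 _ hX _ hX _ _ _ _ h' hC)

theorem SumWellDefined.zero_add (h : F.SumWellDefined) (A : F.Pt) : 0 + A = A := by
  obtain ⟨X, hX⟩ := exists_notMem F
  exact h.add_eq hX (Y := X) ⟨.of_mem_par F.ne (S.par_spec X F.line_mem).2.1, .refl S F.O X, A.2,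
    (PairParallel.refl S X A.1).swap_right⟩

theorem SumWellDefined.add_zero (h : F.SumWellDefined) (A : F.Pt) : A + 0 = A := by
  obtain ⟨X, hX⟩ := exists_notMem F
  obtain ⟨Y, h1, h2⟩ := exists_shift (A := A.1) hX
  exact h.add_eq hX (Y := Y) ⟨h1, h2, A.2, h2.swap_left⟩

theorem pairParallel_OI_trans {X Y Z : P} (h : S.PairParallel X Y F.O F.I)
    (h' : S.PairParallel Y Z F.O F.I) : S.PairParallel X Z F.O F.I := by
  have s := S.par_spec X F.line_mem
  have s' := S.par_spec Y F.line_mem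
  have h1 : Y ∈ S.par X F.line := h.mem_par F.ne
  have h2 : Z ∈ S.par Y F.line := h'.mem_par F.ne
  rw [← (s.2.2.symm.trans s'.2.2 s.1 F.line_mem s'.1).eq_of_mem h1 s'.2.1] at h2
  exact .of_mem_par F.ne h2

/-- Let `Y` be the intermediate point of `B + C` via `X`. Used as auxiliary point, `Y` gives `A + B`
and `A + (B + C)` the same intermediate point `Z`. Chaining parallels, `Z` is also the intermediate
point of `(A + B) + C` via `X`, with the same outcome. -/
theorem SumWellDefined.add_assoc (h : F.SumWellDefined) (A B C : F.Pt) :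
    (A + B) + C = A + (B + C) := by
  obtain ⟨X, hX⟩ := exists_notMem F
  obtain ⟨Y, hY, hBY, hE, hYE⟩ := h.sumVia_add B C hX
  have hYn := notMem_of_pairParallel hX hY
  obtain ⟨Z, hZ, hAZ, hD, hZD⟩ := h.sumVia_add A B hYn
  obtain ⟨Z', hZ', hAZ', hG, hZG⟩ := h.sumVia_add A (B + C) hYn
  obtain rfl := shift_unique hYn hZ hAZ hZ' hAZ'
  refine h.add_eq hX (Y := Z) ⟨pairParallel_OI_trans hY hZ, ?_, hG, ?_⟩
  · exact hZD.swap_left.trans hBY (ne_of_notMem B.2 hYn)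
  · exact hZG.trans hYE.swap_left (ne_of_notMem hE hYn)

/-- Write `E = A + B`, and let `Q` be the intermediate point of `B + A` via `W`; the goal is `QE ∥
AW`. Constructing `E` via both `W` and `V` yields intermediate points `Y` and `R`, and `AW ∥ RB ∥
EQ` follows by Desargues twice. -/
theorem SumWellDefined.add_comm (h : F.SumWellDefined) (hS : S.IsDesarguesian) (A B : F.Pt) :
    A + B = B + A := by
  by_cases hAO : A = 0
  · rw [hAO, h.zero_add, h.add_zero]
  by_cases hBO : B = 0
  · rw [hBO, h.zero_add, h.add_zero]
  by_cases hAB : A = B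
  · rw [hAB]
  have nAO : A.1 ≠ F.O := fun e => hAO (Subtype.ext e)
  have nBO : B.1 ≠ F.O := fun e => hBO (Subtype.ext e)
  have nAB : A.1 ≠ B.1 := fun e => hAB (Subtype.ext e)
  obtain ⟨W, hW⟩ := exists_notMem F
  have nOW := ne_of_notMem F.O_mem hW
  have nBW := ne_of_notMem B.2 hW
  have tOW := transverse F.O_mem hW
  have tBW := transverse B.2 hW
  -- `V` completes the parallelogram `O W B V`
  have sV := S.par_spec B.1 (S.join_spec nOW).1
  have jOW := S.join_spec nOW
  have hBn : B.1 ∉ S.join F.O W := fun hb =>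
    hW (line_eq F.line_mem jOW.1 nBO B.2 F.O_mem hb jOW.2.1 ▸ jOW.2.2)
  have tV : S.Transverse (S.par B.1 (S.join F.O W)) B.1 W :=
    .of_mem_notMem sV.1 sV.1 (.refl _) sV.2.1
      fun hw => hBn (sV.2.2.eq_of_mem jOW.2.2 hw ▸ sV.2.1)
  obtain ⟨V, hV, hOV⟩ := tV.exists_mem sV.1 F.O
  have hBV : S.PairParallel B.1 V F.O W := .of_mem_par nOW hV
  have hVn : V ∉ F.line := by
    intro hVl
    by_cases e : V = F.O
    · rw [e] at hBV
      exact tOW.of_pairParallel F.line_mem hBV.symm nBO _ F.line_mem B.2 F.O_mem (.refl _)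
    · exact tBW.of_pairParallel F.line_mem hOV.symm (Ne.symm e) _ F.line_mem F.O_mem hVl (.refl _)
  have nOV := ne_of_notMem F.O_mem hVn
  have nBV := ne_of_notMem B.2 hVn
  obtain ⟨Y, hY, hAY, hE, hYE⟩ := h.sumVia_add A B hW
  obtain ⟨R, hR, hAR, -, hRE⟩ := h.sumVia_add A B hVn
  obtain ⟨Q, hQ, hBQ⟩ := exists_shift (A := B.1) hW
  have hYn := notMem_of_pairParallel hW hY
  have hRn := notMem_of_pairParallel hVn hR
  have hQn := notMem_of_pairParallel hW hQ
  have nAY := ne_of_notMem A.2 hYn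
  have nAR := ne_of_notMem A.2 hRn
  have nBQ := ne_of_notMem B.2 hQn
  have nER := ne_of_notMem hE hRn
  -- `E = A` would make `BW` parallel to `OW`, hence `B = O`.
  have nEA : (A + B).1 ≠ A.1 := by
    intro e
    rw [e] at hYE
    have h1 : S.PairParallel W B.1 F.O W := (hYE.symm.trans hAY.swap_left nAY.symm).swap_left
    exact nBO (tOW.eq_of_mem F.line_mem B.2 F.O_mem h1 (PairParallel.refl S W F.O).swap_right)
  have hER : S.PairParallel (A + B).1 R F.O W := hRE.swap_left.trans hBV nBV
  -- `E = B` would force `Y = W`, hence `AW ∥ OW` and `A = O`.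
  have nEB : (A + B).1 ≠ B.1 := by
    intro e
    rw [e] at hYE
    have h1 : W = Y := (transverse_par B.2 hW).eq_of_mem (S.par_spec W F.line_mem).1
      (S.par_spec W F.line_mem).2.1 (hY.mem_par F.ne) (.refl S B.1 W) hYE.swap_left
    rw [← h1] at hAY
    exact nAO (tOW.eq_of_mem F.line_mem A.2 F.O_mem hAY.swap_left
      (PairParallel.refl S W F.O).swap_right)
  -- distinct points of `OI` lie on distinct lines of a transverse direction
  have hdist : ∀ {p q x y : P}, p ∈ F.line → q ∈ F.line → x ∉ F.line →
      p ≠ x → q ≠ y → p ≠ q → S.join p x ≠ S.join q y := by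
    intro p q x y hp hq hx npx nqy npq e
    exact hx (line_eq F.line_mem (S.join_spec npx).1 npq hp hq (S.join_spec npx).2.1
      (e ▸ (S.join_spec nqy).2.1) ▸ (S.join_spec npx).2.2)
  -- Triangles `AOW` and `RVB` on the parallels `AR`, `OV`, `BW`.
  have hAWRB : S.PairParallel A.1 W R B.1 := by
    have j1 := S.join_spec nAR
    have j2 := S.join_spec nOV
    have j3 := S.join_spec nBW
    refine hS.parallel j1.1 j2.1 j3.1 (hAR.join_parallel nAR nOV) (hOV.join_parallel nOV nBW)
      (hdist A.2 F.O_mem hRn nAR nOV nAO)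
      (hdist F.O_mem B.2 hVn nOV nBW nBO.symm)
      (hdist A.2 B.2 hRn nAR nBW nAB)
      j1.2.1 j1.2.2 j2.2.1 j2.2.2 j3.2.2 j3.2.1 ?_ hBV.symm.swap_right
    exact ((hR.trans (pairParallel_of_mem F.O_mem F.I_mem A.2 F.O_mem) F.ne).symm).swap_right
  -- Triangles `RAB` and `EYQ` on the parallels `ER`, `AY`, `BQ`.
  have hRBEQ : S.PairParallel R B.1 (A + B).1 Q := by
    have j1 := S.join_spec nER
    have j2 := S.join_spec nAY
    have j3 := S.join_spec nBQ
    refine hS.parallel j1.1 j2.1 j3.1 ((hER.trans hAY.symm nOW).join_parallel nER nAY)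
      ((hAY.trans hBQ.symm nOW).join_parallel nAY nBQ)
      (hdist hE A.2 hRn nER nAY nEA)
      (hdist A.2 B.2 hYn nAY nBQ nAB)
      (hdist hE B.2 hRn nER nBQ nEB)
      j1.2.2 j1.2.1 j2.2.1 j2.2.2 j3.2.1 j3.2.2 ?_ ?_
    · exact (hAR.swap_left.trans (hOV.trans hYE.symm nBW) nOV).swap_right
    · have hYW : S.PairParallel Y W F.O F.I := hY.swap_left
      exact ((pairParallel_OI_trans hYW hQ).trans
        (pairParallel_of_mem F.O_mem F.I_mem A.2 B.2) F.ne).symm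
  exact (h.add_eq hW (Y := Q) ⟨hQ, hBQ, hE,
    (hAWRB.trans hRBEQ (ne_of_notMem B.2 hRn).symm).symm.swap_left⟩).symm

theorem SumWellDefined.sub_self (h : F.SumWellDefined) (hS : S.IsDesarguesian) (A : F.Pt) :
    A - A = 0 := by
  have hex : ∃ N : F.Pt, A + N = 0 ∧ N + A = 0 := by
    obtain ⟨X, hX⟩ := exists_notMem F
    obtain ⟨Y, h1, h2⟩ := exists_shift (A := A.1) hX
    have hYn := notMem_of_pairParallel hX h1
    -- The construction run backwards: `XN ∥ OY` makes the sum of `A` and `N` end at `O`.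
    obtain ⟨N, hN, h3⟩ := (transverse F.O_mem hYn).exists_mem F.line_mem X
    have hsum : A + ⟨N, hN⟩ = (0 : F.Pt) :=
      h.add_eq hX (Y := Y) ⟨h1, h2, F.O_mem, h3.symm.swap⟩
    exact ⟨⟨N, hN⟩, hsum, h.add_comm hS A ⟨N, hN⟩ ▸ hsum⟩
  exact (Classical.epsilon_spec hex).1

/-! ### Products with a zero factor and the cross-ratio at `B` -/

theorem transverse_join {X : P} (hX : X ∉ F.line) :
    S.Transverse (S.join F.O X) F.I X := by
  have j := S.join_spec (ne_of_notMem F.O_mem hX)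
  refine .symm (.of_mem_notMem j.1 j.1 (.refl _) j.2.2 fun h => ?_)
  exact hX (line_eq F.line_mem j.1 F.ne F.O_mem F.I_mem j.2.1 h ▸ j.2.2)

theorem exists_isProd (A B : F.Pt) : ∃ C : F.Pt, F.IsProd A.1 B.1 C.1 := by
  obtain ⟨X, hX⟩ := exists_notMem F
  have j := S.join_spec (ne_of_notMem F.O_mem hX)
  obtain ⟨Y, hY, h⟩ := (transverse_join hX).exists_mem j.1 A.1
  obtain ⟨C, hC, h'⟩ := (transverse B.2 hX).exists_mem F.line_mem Y
  exact ⟨⟨C, hC⟩, X, hX, Y, (transverse_join hX).par_inter j.1 hY h,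
    (transverse B.2 hX).par_inter F.line_mem hC h'⟩

theorem isProd_mul (A B : F.Pt) : F.IsProd A.1 B.1 (A * B).1 :=
  Classical.epsilon_spec (exists_isProd A B)

/-- The intermediate point already lies on `OX`, so its parallel to `OX` is `OX` itself, which meets
`OI` in `O`. -/
theorem mul_zero (A : F.Pt) : A * 0 = 0 := by
  obtain ⟨X, hX, Y, h1, h2⟩ := isProd_mul A 0
  have nOX := ne_of_notMem F.O_mem hX
  have hY : Y ∈ S.par A.1 (S.join F.I X) ∩ S.join F.O X := h1 ▸ rfl
  have hC : (A * 0).1 ∈ S.par Y (S.join F.O X) ∩ F.line := h2 ▸ rfl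
  have j := S.join_spec nOX
  exact Subtype.ext ((transverse F.O_mem hX).eq_of_mem F.line_mem hC.2 F.O_mem
    (.of_mem_par nOX hC.1) (.of_mem j.1 j.1 (.refl _) hY.2 j.2.1 j.2.1 j.2.2))

/-- The parallel to `IX` through `O` meets `OX` in `O`, so the intermediate point is `O`, already on
`OI`. -/
theorem zero_mul (B : F.Pt) : 0 * B = 0 := by
  obtain ⟨X, hX, Y, h1, h2⟩ := isProd_mul 0 B
  have nIX := ne_of_notMem F.I_mem hX
  have nBX := ne_of_notMem B.2 hX
  have j := S.join_spec (ne_of_notMem F.O_mem hX)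
  have hY : Y ∈ S.par F.O (S.join F.I X) ∩ S.join F.O X := h1 ▸ rfl
  have hC : (0 * B).1 ∈ S.par Y (S.join B.1 X) ∩ F.line := h2 ▸ rfl
  have sO := S.par_spec F.O (S.join_spec nIX).1
  have e : Y = F.O := (transverse_join hX).eq_of_mem j.1 hY.2 j.2.1
    (.of_mem_par nIX hY.1) (.of_mem_par nIX sO.2.1)
  rw [e] at hC
  exact Subtype.ext ((transverse B.2 hX).eq_of_mem F.line_mem hC.2 F.O_mem
    (.of_mem_par nBX hC.1) (.of_mem_par nBX (S.par_spec F.O (S.join_spec nBX).1).2.1))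

theorem SumWellDefined.fD_self (h : F.SumWellDefined) (hS : S.IsDesarguesian) (A B C : F.Pt) :
    fD A B C B = 0 := by
  rw [fD, crossRatio, h.sub_self hS B, mul_zero, zero_mul]

end Frame

end AffinePlane

theorem theorem2p10 {P : Type*} (S : AffinePlane P) (hS : S.IsDesarguesian) (F : S.Frame)
    (A B C : F.Pt) (hAB : A ≠ B) (hAC : A ≠ C) (hBC : B ≠ C)
    (hA : A ≠ 0) (hB : B ≠ 0) (hC : C ≠ 0) :
    (∀ u ∈ AffinePlane.Frame.ratioSetD A B C, ∀ v ∈ AffinePlane.Frame.ratioSetD A B C,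
      ∀ w ∈ AffinePlane.Frame.ratioSetD A B C, (u + v) + w = u + (v + w)) ∧
    (∀ u ∈ AffinePlane.Frame.ratioSetD A B C, ∀ v ∈ AffinePlane.Frame.ratioSetD A B C,
      u + v = v + u) ∧
    (AffinePlane.Frame.fD A B C B ∈ AffinePlane.Frame.ratioSetD A B C ∧
      AffinePlane.Frame.fD A B C B = 0 ∧
      ∀ u ∈ AffinePlane.Frame.ratioSetD A B C,
        u + AffinePlane.Frame.fD A B C B = u ∧ AffinePlane.Frame.fD A B C B + u = u) := by
  -- `A` and `B` are the two distinct points of `OI` other than `O` required for a third auxiliary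
  -- point.
  have hF : F.SumWellDefined := fun _ hA' _ hB' _ hX _ hX' _ _ _ _ h h' =>
    AffinePlane.Frame.sumVia_unique hS A.2 B.2 (fun e => hA (Subtype.ext e))
      (fun e => hB (Subtype.ext e)) (fun e => hAB (Subtype.ext e)) hA' hB' hX hX' h h'
  have hfB := hF.fD_self hS A B C
  refine ⟨fun u _ v _ w _ => hF.add_assoc u v w, fun u _ v _ => hF.add_comm hS u v,
    ⟨B, hAB.symm, rfl⟩, hfB, fun u _ => ?_⟩
  rw [hfB]
  exact ⟨hF.add_zero u, hF.zero_add u⟩
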